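/- Let $k$ be a field, $q\in k^{\times}$, and let $H_q$ be the $k$-algebra generated by $D_1,D_2,\sigma^{\pm1}$ subject to $$D_1D_2=D_2D_1,\qquad \sigma\sigma^{-1}=\sigma^{-1}\sigma=1,\qquad q\sigma D_i=D_i\sigma\quad(i=1,2),$$ and, in case $q$ is a primitive $l$-th root of unity with $l\ge 2$, also to $D_1^l=D_2^l=0$. It is a Hopf algebra with $$\Delta(D_1)=D_1\otimes\sigma+1\otimes D_1,\quad \Delta(D_2)=D_2\otimes 1+\sigma\otimes D_2,\quad \Delta(\sigma)=\sigma\otimes\sigma,$$ $$\epsilon(D_1)=\epsilon(D_2)=0,\quad \epsilon(\sigma)=1,\quad S(D_1)=-D_1\sigma^{-1},\quad S(D_2)=-\sigma^{-1}D_2,\quad S(\sigma)=\sigma^{-1}.$$ Let $A$ be an associative unital $k$-algebra and $\otimes=\otimes_k$. A \emph{transposition} of $H_q$ on $A$ is a bijective $k$-linear map $s\colon H_q\otimes A\to A\otimes H_q$ that is compatible with the unit and multiplication of $H_q$ ($s(1\otimes a)=a\otimes 1$ and $s\circ(\mu\otimes A)=(A\otimes\mu)\circ(s\otimes H_q)\circ(H_q\otimes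 s)$), with its counit and comultiplication ($(A\otimes\epsilon)\circ s=\epsilon\otimes A$ and $(A\otimes\Delta)\circ s=(s\otimes H_q)\circ(H_q\otimes s)\circ(\Delta\otimes A)$), with the flip $\tau$ of $H_q\otimes H_q$ ($(s\otimes H_q)\circ(H_q\otimes s)\circ(\tau\otimes A)=(A\otimes\tau)\circ(s\otimes H_q)\circ(H_q\otimes s)$), and with the unit and multiplication of $A$ ($s(h\otimes 1)=1\otimes h$ and $s\circ(H_q\otimes\mu_A)=(\mu_A\otimes H_q)\circ(A\otimes s)\circ(s\otimes A)$). It is \emph{good} if $$(s\otimes H_q)\circ(H_q\otimes s)(D_1\otimes D_2\otimes a)=a\otimes D_1\otimes D_2\quad\text{for all }a\in A.$$ Then the following facts hold. 1. If $s\colon H_q\otimes A\to A\otimes H_q$ is a good transposition, then $s(\sigma\otimes a)=a\otimes\sigma$ and $s(\sigma^{-1}\otimes a)=a\otimes\sigma^{-1}$ for all $a\in A$; moreover there is a unique map $\alpha\colon A\to A$ such that $s(D_1\otimes a)=\alpha(a)\otimes D_1$ for all $a\in A$, and $\alpha$ is an algebra homomorphism. 2. For every algebra automorphism $\alpha\colon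 A\to A$ there exists one and only one good transposition $s\colon H_q\otimes A\to A\otimes H_q$ such that $s(D_1\otimes a)=\alpha(a)\otimes D_1$ for all $a\in A$. -/

import Mathlib

open scoped TensorProduct

/-! ## The Hopf algebra `H_q` -/

/-- The generators `D₁, D₂, σ, σ⁻¹`. -/
inductive HqGen : Type
  | D₁ : HqGen
  | D₂ : HqGen
  | σ : HqGen
  | σInv : HqGen

/-- The defining relations of `H_q`. The last two are present only if `q` is a primitive `l`-th root
of unity for some `l ≥ 2`; for `q = 1`, or `q` not a root of unity, they are void. -/
inductive HqRel (k : Type*) [Field k] (q : kˣ) :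
    FreeAlgebra k HqGen → FreeAlgebra k HqGen → Prop
  | D₁_mul_D₂ : HqRel k q (FreeAlgebra.ι k HqGen.D₁ * FreeAlgebra.ι k HqGen.D₂)
      (FreeAlgebra.ι k HqGen.D₂ * FreeAlgebra.ι k HqGen.D₁)
  | σ_mul_σInv : HqRel k q (FreeAlgebra.ι k HqGen.σ * FreeAlgebra.ι k HqGen.σInv) 1
  | σInv_mul_σ : HqRel k q (FreeAlgebra.ι k HqGen.σInv * FreeAlgebra.ι k HqGen.σ) 1
  | σ_mul_D₁ : HqRel k q ((q : k) • (FreeAlgebra.ι k HqGen.σ * FreeAlgebra.ι k HqGen.D₁))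
      (FreeAlgebra.ι k HqGen.D₁ * FreeAlgebra.ι k HqGen.σ)
  | σ_mul_D₂ : HqRel k q ((q : k) • (FreeAlgebra.ι k HqGen.σ * FreeAlgebra.ι k HqGen.D₂))
      (FreeAlgebra.ι k HqGen.D₂ * FreeAlgebra.ι k HqGen.σ)
  | D₁_pow (l : ℕ) (hl : 2 ≤ l) (hq : IsPrimitiveRoot (q : k) l) :
      HqRel k q (FreeAlgebra.ι k HqGen.D₁ ^ l) 0
  | D₂_pow (l : ℕ) (hl : 2 ≤ l) (hq : IsPrimitiveRoot (q : k) l) :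
      HqRel k q (FreeAlgebra.ι k HqGen.D₂ ^ l) 0

/-- The algebra `H_q`, given by generators and relations. -/
def Hq (k : Type*) [Field k] (q : kˣ) : Type _ := RingQuot (HqRel k q)

namespace Hq

noncomputable section

variable {k : Type*} [Field k] {q : kˣ}

instance instRing : Ring (Hq k q) := inferInstanceAs (Ring (RingQuot (HqRel k q)))

instance instAlgebra : Algebra k (Hq k q) := inferInstanceAs (Algebra k (RingQuot (HqRel k q)))

/-- The quotient map from the free algebra. -/
def mk (k : Type*) [Field k] (q : kˣ) : FreeAlgebra k HqGen →ₐ[k] Hq k q :=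
  RingQuot.mkAlgHom k (HqRel k q)

/-- The generator `D₁` of `H_q`. -/
def D₁ (k : Type*) [Field k] (q : kˣ) : Hq k q := mk k q (FreeAlgebra.ι k HqGen.D₁)

/-- The generator `D₂` of `H_q`. -/
def D₂ (k : Type*) [Field k] (q : kˣ) : Hq k q := mk k q (FreeAlgebra.ι k HqGen.D₂)

/-- The generator `σ` of `H_q`. -/
def σ (k : Type*) [Field k] (q : kˣ) : Hq k q := mk k q (FreeAlgebra.ι k HqGen.σ)

/-- The generator `σ⁻¹` of `H_q`. -/
def σInv (k : Type*) [Field k] (q : kˣ) : Hq k q := mk k q (FreeAlgebra.ι k HqGen.σInv)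

theorem mk_rel {x y : FreeAlgebra k HqGen} (h : HqRel k q x y) : mk k q x = mk k q y :=
  RingQuot.mkAlgHom_rel k h

theorem D₁_mul_D₂ : D₁ k q * D₂ k q = D₂ k q * D₁ k q := by
  simpa [D₁, D₂, σ, σInv] using mk_rel (HqRel.D₁_mul_D₂ (k := k) (q := q))

theorem σ_mul_σInv : σ k q * σInv k q = 1 := by
  simpa [D₁, D₂, σ, σInv] using mk_rel (HqRel.σ_mul_σInv (k := k) (q := q))

theorem σInv_mul_σ : σInv k q * σ k q = 1 := by
  simpa [D₁, D₂, σ, σInv] using mk_rel (HqRel.σInv_mul_σ (k := k) (q := q))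

theorem D₁_mul_σ : D₁ k q * σ k q = (q : k) • (σ k q * D₁ k q) := by
  simpa [D₁, D₂, σ, σInv] using (mk_rel (HqRel.σ_mul_D₁ (k := k) (q := q))).symm

theorem D₂_mul_σ : D₂ k q * σ k q = (q : k) • (σ k q * D₂ k q) := by
  simpa [D₁, D₂, σ, σInv] using (mk_rel (HqRel.σ_mul_D₂ (k := k) (q := q))).symm

theorem D₁_pow {l : ℕ} (hl : 2 ≤ l) (hq : IsPrimitiveRoot (q : k) l) : D₁ k q ^ l = 0 := by
  simpa [D₁, D₂, σ, σInv] using mk_rel (HqRel.D₁_pow l hl hq)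

theorem D₂_pow {l : ℕ} (hl : 2 ≤ l) (hq : IsPrimitiveRoot (q : k) l) : D₂ k q ^ l = 0 := by
  simpa [D₁, D₂, σ, σInv] using mk_rel (HqRel.D₂_pow l hl hq)

section UniversalProperty

variable {B : Type*} [Ring B] [Algebra k B]

/-- The values on the generators of an algebra map out of `H_q`. -/
def genFun (d₁ d₂ s t : B) : HqGen → B
  | .D₁ => d₁
  | .D₂ => d₂
  | .σ => s
  | .σInv => t

/-- The algebra map out of `H_q` with given values on the generators. -/
def lift (d₁ d₂ s t : B) (h₁ : d₁ * d₂ = d₂ * d₁) (h₂ : s * t = 1) (h₃ : t * s = 1)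
    (h₄ : d₁ * s = (q : k) • (s * d₁)) (h₅ : d₂ * s = (q : k) • (s * d₂))
    (h₆ : ∀ l, 2 ≤ l → IsPrimitiveRoot (q : k) l → d₁ ^ l = 0)
    (h₇ : ∀ l, 2 ≤ l → IsPrimitiveRoot (q : k) l → d₂ ^ l = 0) : Hq k q →ₐ[k] B :=
  RingQuot.liftAlgHom k ⟨FreeAlgebra.lift k (genFun d₁ d₂ s t), by
    intro x y h
    cases h with
    | D₁_mul_D₂ => simpa [genFun] using h₁
    | σ_mul_σInv => simpa [genFun] using h₂
    | σInv_mul_σ => simpa [genFun] using h₃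
    | σ_mul_D₁ => simpa [genFun] using h₄.symm
    | σ_mul_D₂ => simpa [genFun] using h₅.symm
    | D₁_pow l hl hq => simpa [genFun] using h₆ l hl hq
    | D₂_pow l hl hq => simpa [genFun] using h₇ l hl hq⟩

variable {d₁ d₂ s t : B} {h₁ : d₁ * d₂ = d₂ * d₁} {h₂ : s * t = 1} {h₃ : t * s = 1}
    {h₄ : d₁ * s = (q : k) • (s * d₁)} {h₅ : d₂ * s = (q : k) • (s * d₂)}
    {h₆ : ∀ l, 2 ≤ l → IsPrimitiveRoot (q : k) l → d₁ ^ l = 0}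
    {h₇ : ∀ l, 2 ≤ l → IsPrimitiveRoot (q : k) l → d₂ ^ l = 0}

theorem lift_mk (x : FreeAlgebra k HqGen) :
    lift d₁ d₂ s t h₁ h₂ h₃ h₄ h₅ h₆ h₇ (mk k q x) = FreeAlgebra.lift k (genFun d₁ d₂ s t) x :=
  RingQuot.liftAlgHom_mkAlgHom_apply k _ _ x

@[simp] theorem lift_D₁ : lift d₁ d₂ s t h₁ h₂ h₃ h₄ h₅ h₆ h₇ (D₁ k q) = d₁ := by
  rw [D₁, lift_mk, FreeAlgebra.lift_ι_apply, genFun]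

@[simp] theorem lift_D₂ : lift d₁ d₂ s t h₁ h₂ h₃ h₄ h₅ h₆ h₇ (D₂ k q) = d₂ := by
  rw [D₂, lift_mk, FreeAlgebra.lift_ι_apply, genFun]

@[simp] theorem lift_σ : lift d₁ d₂ s t h₁ h₂ h₃ h₄ h₅ h₆ h₇ (σ k q) = s := by
  rw [σ, lift_mk, FreeAlgebra.lift_ι_apply, genFun]

@[simp] theorem lift_σInv : lift d₁ d₂ s t h₁ h₂ h₃ h₄ h₅ h₆ h₇ (σInv k q) = t := by
  rw [σInv, lift_mk, FreeAlgebra.lift_ι_apply, genFun]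

theorem algHom_ext {f g : Hq k q →ₐ[k] B} (h₁ : f (D₁ k q) = g (D₁ k q))
    (h₂ : f (D₂ k q) = g (D₂ k q)) (h₃ : f (σ k q) = g (σ k q))
    (h₄ : f (σInv k q) = g (σInv k q)) : f = g := by
  refine RingQuot.ringQuot_ext' k (s := HqRel k q) f g (FreeAlgebra.hom_ext (funext fun x => ?_))
  cases x
  · exact h₁
  · exact h₂
  · exact h₃
  · exact h₄

theorem induction {P : Hq k q → Prop} (hD₁ : P (D₁ k q)) (hD₂ : P (D₂ k q)) (hσ : P (σ k q))
    (hσInv : P (σInv k q)) (hs : ∀ r : k, P (algebraMap k _ r))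
    (hadd : ∀ x y, P x → P y → P (x + y)) (hmul : ∀ x y, P x → P y → P (x * y))
    (x : Hq k q) : P x := by
  obtain ⟨x, rfl⟩ := RingQuot.mkAlgHom_surjective k (HqRel k q) x
  change P (mk k q x)
  induction x using FreeAlgebra.induction with
  | grade0 r => rw [AlgHom.commutes]; exact hs r
  | grade1 g => cases g <;> assumption
  | mul a b ha hb => rw [map_mul]; exact hmul _ _ ha hb
  | add a b ha hb => rw [map_add]; exact hadd _ _ ha hb

end UniversalProperty

/-! ### The `q`-binomial formula at a primitive root of unity -/

/-- Gaussian binomial coefficients. -/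
def qBinom (r : k) : ℕ → ℕ → k
  | _, 0 => 1
  | 0, _ + 1 => 0
  | n + 1, i + 1 => qBinom r n i + r ^ (i + 1) * qBinom r n (i + 1)

/-- `(n)_r = 1 + r + ⋯ + r ^ (n - 1)`. -/
def qNum (r : k) (n : ℕ) : k := ∑ i ∈ Finset.range n, r ^ i

theorem qNum_succ (r : k) (n : ℕ) : qNum r (n + 1) = 1 + r * qNum r n := by
  rw [qNum, qNum, Finset.sum_range_succ', Finset.mul_sum]
  simp [pow_succ', add_comm]

theorem qNum_mul_qBinom (r : k) (n i : ℕ) :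
    qNum r (i + 1) * qBinom r (n + 1) (i + 1) = qNum r (n + 1) * qBinom r n i := by
  induction n generalizing i with
  | zero => cases i <;> simp [qBinom, qNum]
  | succ n ih =>
    rw [qBinom]
    have h := ih i
    cases i with
    | zero =>
      rw [qNum_succ r (n + 1)]
      simp only [qBinom] at h ⊢
      linear_combination (r ^ (0 + 1)) * h + (qNum_succ r 0) + (by simp [qNum] : (r * qNum r 0 : k) = 0)
    | succ j =>
      have h' := ih j
      rw [qNum_succ r (n + 1)]
      simp only [qBinom] at h h' ⊢
      have e := qNum_succ r (j + 1)
      linear_combination (r ^ (j + 1 + 1)) * h + r * h' +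
        (qBinom r n j + r ^ (j + 1) * qBinom r n (j + 1)) * e

theorem qBinom_eq_zero_of_lt (r : k) (n i : ℕ) (h : n < i) : qBinom r n i = 0 := by
  induction n generalizing i with
  | zero => obtain ⟨j, rfl⟩ := Nat.exists_eq_succ_of_ne_zero h.ne'; rfl
  | succ n ih =>
    obtain ⟨j, rfl⟩ := Nat.exists_eq_succ_of_ne_zero (Nat.ne_zero_of_lt h)
    rw [Nat.succ_eq_add_one, qBinom, ih j (by omega), ih (j + 1) (by omega)]
    simp

theorem qBinom_self (r : k) (n : ℕ) : qBinom r n n = 1 := by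
  induction n with
  | zero => rfl
  | succ n ih => rw [qBinom, ih, qBinom_eq_zero_of_lt r n (n + 1) (by omega)]; simp

theorem qBinom_eq_zero {r : k} {l i : ℕ} (hr : IsPrimitiveRoot r l) (hi : 0 < i) (hil : i < l) :
    qBinom r l i = 0 := by
  obtain ⟨j, rfl⟩ := Nat.exists_eq_succ_of_ne_zero hi.ne'
  obtain ⟨n, rfl⟩ := Nat.exists_eq_succ_of_ne_zero (Nat.ne_zero_of_lt hil)
  have h := qNum_mul_qBinom r n j
  have h0 : qNum r (n + 1) = 0 := hr.geom_sum_eq_zero (by omega)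
  rw [h0, zero_mul] at h
  refine (mul_eq_zero.mp h).resolve_left fun hz => ?_
  have := geom_sum_mul r (j + 1)
  rw [← qNum, hz, zero_mul] at this
  exact hr.pow_ne_one_of_pos_of_lt (by omega) hil (sub_eq_zero.mp this.symm)

section

variable {B : Type*} [Ring B] [Algebra k B]

theorem skew_pow {r : k} {x y : B} (h : y * x = r • (x * y)) (n : ℕ) :
    y * x ^ n = r ^ n • (x ^ n * y) := by
  induction n with
  | zero => simp
  | succ n ih =>
    rw [pow_succ, ← mul_assoc, ih, smul_mul_assoc, mul_assoc, h, mul_smul_comm, smul_smul,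
      pow_succ, mul_assoc]

theorem add_pow_skew {r : k} {x y : B} (h : y * x = r • (x * y)) (n : ℕ) :
    (x + y) ^ n = ∑ i ∈ Finset.range (n + 1), qBinom r n i • (x ^ i * y ^ (n - i)) := by
  induction n with
  | zero => simp [qBinom]
  | succ n ih =>
    have h1 : x * ∑ i ∈ Finset.range (n + 1), qBinom r n i • (x ^ i * y ^ (n - i)) =
        ∑ i ∈ Finset.range (n + 1), qBinom r n i • (x ^ (i + 1) * y ^ (n + 1 - (i + 1))) := by
      rw [Finset.mul_sum]
      refine Finset.sum_congr rfl fun i _ => ?_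
      rw [mul_smul_comm, ← mul_assoc, ← pow_succ']
      simp
    have h2 : y * ∑ i ∈ Finset.range (n + 1), qBinom r n i • (x ^ i * y ^ (n - i)) =
        ∑ i ∈ Finset.range (n + 2), (r ^ i * qBinom r n i) • (x ^ i * y ^ (n + 1 - i)) := by
      rw [Finset.mul_sum, Finset.sum_range_succ _ (n + 1),
        qBinom_eq_zero_of_lt r n (n + 1) (by omega)]
      simp only [mul_zero, zero_smul, add_zero]
      refine Finset.sum_congr rfl fun i hi => ?_
      rw [mul_smul_comm, ← mul_assoc, skew_pow h, smul_mul_assoc, smul_smul, mul_assoc, ← pow_succ',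
        mul_comm (r ^ i), Nat.sub_add_comm (by simpa [Nat.lt_succ_iff] using hi)]
    rw [pow_succ', ih, add_mul, h1, h2, Finset.sum_range_succ' _ (n + 1),
      Finset.sum_range_succ' _ (n + 1), ← add_assoc, ← Finset.sum_add_distrib]
    congr 1
    · refine Finset.sum_congr rfl fun i _ => ?_
      rw [← add_smul, qBinom]
    · simp [qBinom]

theorem add_pow_primitiveRoot {r : k} {l : ℕ} (hl : 2 ≤ l) (hr : IsPrimitiveRoot r l) {x y : B}
    (h : y * x = r • (x * y)) (hx : x ^ l = 0) (hy : y ^ l = 0) : (x + y) ^ l = 0 := by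
  rw [add_pow_skew h]
  refine Finset.sum_eq_zero fun i hi => ?_
  rcases Nat.eq_zero_or_pos i with rfl | hi0
  · simp [hy]
  · rcases eq_or_lt_of_le (Nat.lt_succ_iff.mp (Finset.mem_range.mp hi)) with rfl | hil
    · simp [hx]
    · rw [qBinom_eq_zero hr hi0 hil, zero_smul]

theorem mul_pow_eq_zero_of_skew {r : k} {x y : B} (h : y * x = r • (x * y)) {l : ℕ}
    (hx : x ^ l = 0) : (x * y) ^ l = 0 := by
  have key : ∀ n : ℕ, ∃ c : k, (x * y) ^ n = c • (x ^ n * y ^ n) := by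
    intro n
    induction n with
    | zero => exact ⟨1, by simp⟩
    | succ n ih =>
      obtain ⟨c, hc⟩ := ih
      refine ⟨c * r ^ n, ?_⟩
      rw [pow_succ', hc, mul_smul_comm, mul_assoc, ← mul_assoc y, skew_pow h, smul_mul_assoc,
        mul_smul_comm, smul_smul, mul_assoc, ← mul_assoc x, ← pow_succ', ← pow_succ']
  obtain ⟨c, hc⟩ := key l
  rw [hc, hx, zero_mul, smul_zero]

end

/-! ### The bialgebra and Hopf algebra structures -/

/-- The comultiplication `Δ(D₁) = D₁ ⊗ σ + 1 ⊗ D₁`, `Δ(D₂) = D₂ ⊗ 1 + σ ⊗ D₂`, `Δ(σ^{±1}) =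
σ^{±1} ⊗ σ^{±1}`. -/
def comulHom (k : Type*) [Field k] (q : kˣ) : Hq k q →ₐ[k] Hq k q ⊗[k] Hq k q :=
  lift (D₁ k q ⊗ₜ σ k q + 1 ⊗ₜ D₁ k q) (D₂ k q ⊗ₜ 1 + σ k q ⊗ₜ D₂ k q) (σ k q ⊗ₜ σ k q)
    (σInv k q ⊗ₜ σInv k q)
    (by
      simp only [add_mul, mul_add, Algebra.TensorProduct.tmul_mul_tmul, one_mul, mul_one,
        D₁_mul_D₂, D₁_mul_σ, D₂_mul_σ, TensorProduct.tmul_smul, TensorProduct.smul_tmul']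
      abel)
    (by simp [σ_mul_σInv, Algebra.TensorProduct.one_def])
    (by simp [σInv_mul_σ, Algebra.TensorProduct.one_def])
    (by
      simp only [add_mul, mul_add, Algebra.TensorProduct.tmul_mul_tmul, one_mul, mul_one,
        D₁_mul_σ, TensorProduct.tmul_smul, TensorProduct.smul_tmul', smul_add])
    (by
      simp only [add_mul, mul_add, Algebra.TensorProduct.tmul_mul_tmul, one_mul, mul_one,
        D₂_mul_σ, TensorProduct.tmul_smul, TensorProduct.smul_tmul', smul_add])
    (fun l hl hq => by
      refine add_pow_primitiveRoot hl hq ?_ ?_ ?_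
      · simp only [Algebra.TensorProduct.tmul_mul_tmul, one_mul, mul_one, D₁_mul_σ,
          TensorProduct.tmul_smul]
      · rw [Algebra.TensorProduct.tmul_pow, D₁_pow hl hq, TensorProduct.zero_tmul]
      · rw [Algebra.TensorProduct.tmul_pow, D₁_pow hl hq, TensorProduct.tmul_zero])
    (fun l hl hq => by
      rw [add_comm]
      refine add_pow_primitiveRoot hl hq ?_ ?_ ?_
      · simp only [Algebra.TensorProduct.tmul_mul_tmul, one_mul, mul_one, D₂_mul_σ,
          TensorProduct.smul_tmul']
      · rw [Algebra.TensorProduct.tmul_pow, D₂_pow hl hq, TensorProduct.tmul_zero]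
      · rw [Algebra.TensorProduct.tmul_pow, D₂_pow hl hq, TensorProduct.zero_tmul])

/-- The counit `ε(D₁) = ε(D₂) = 0`, `ε(σ^{±1}) = 1`. -/
def counitHom (k : Type*) [Field k] (q : kˣ) : Hq k q →ₐ[k] k :=
  lift 0 0 1 1 (by simp) (by simp) (by simp) (by simp) (by simp)
    (fun _ hl _ => zero_pow (by omega)) (fun _ hl _ => zero_pow (by omega))

instance instBialgebra : Bialgebra k (Hq k q) :=
  Bialgebra.ofAlgHom (comulHom k q) (counitHom k q)
    (by
      apply algHom_ext <;>
        simp [comulHom, TensorProduct.add_tmul, TensorProduct.tmul_add,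
          Algebra.TensorProduct.one_def, add_assoc])
    (by
      apply algHom_ext <;> simp [comulHom, counitHom])
    (by
      apply algHom_ext <;> simp [comulHom, counitHom])

theorem comul_D₁ : Coalgebra.comul (R := k) (D₁ k q) = D₁ k q ⊗ₜ σ k q + 1 ⊗ₜ D₁ k q :=
  lift_D₁

theorem comul_D₂ : Coalgebra.comul (R := k) (D₂ k q) = D₂ k q ⊗ₜ 1 + σ k q ⊗ₜ D₂ k q :=
  lift_D₂

theorem comul_σ : Coalgebra.comul (R := k) (σ k q) = σ k q ⊗ₜ σ k q :=
  lift_σ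

theorem comul_σInv : Coalgebra.comul (R := k) (σInv k q) = σInv k q ⊗ₜ σInv k q :=
  lift_σInv

theorem counit_D₁ : Coalgebra.counit (R := k) (D₁ k q) = 0 :=
  lift_D₁

theorem counit_D₂ : Coalgebra.counit (R := k) (D₂ k q) = 0 :=
  lift_D₂

theorem counit_σ : Coalgebra.counit (R := k) (σ k q) = 1 :=
  lift_σ

theorem counit_σInv : Coalgebra.counit (R := k) (σInv k q) = 1 :=
  lift_σInv

theorem σInv_mul_skew {d : Hq k q} (h : d * σ k q = (q : k) • (σ k q * d)) :
    σInv k q * d = (q : k) • (d * σInv k q) := by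
  calc σInv k q * d = σInv k q * (d * σ k q) * σInv k q := by
        rw [mul_assoc, mul_assoc, σ_mul_σInv, mul_one]
    _ = (q : k) • (d * σInv k q) := by
        rw [h, mul_smul_comm, smul_mul_assoc, ← mul_assoc, σInv_mul_σ, one_mul]

/-- The antipode `S(D₁) = -D₁σ⁻¹`, `S(D₂) = -σ⁻¹D₂`, `S(σ^{±1}) = σ^{∓1}`, as an algebra map into
the opposite algebra. -/
def antipodeHom (k : Type*) [Field k] (q : kˣ) : Hq k q →ₐ[k] (Hq k q)ᵐᵒᵖ :=
  lift (MulOpposite.op (-(D₁ k q * σInv k q))) (MulOpposite.op (-(σInv k q * D₂ k q)))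
    (MulOpposite.op (σInv k q)) (MulOpposite.op (σ k q))
    (by
      rw [← MulOpposite.op_mul, ← MulOpposite.op_mul, neg_mul_neg, neg_mul_neg,
        σInv_mul_skew D₂_mul_σ, smul_mul_assoc, mul_smul_comm, mul_assoc, mul_assoc,
        ← mul_assoc (σInv k q) (D₁ k q), σInv_mul_skew D₁_mul_σ, ← mul_assoc (σInv k q) (D₂ k q),
        σInv_mul_skew D₂_mul_σ, smul_mul_assoc, smul_mul_assoc, mul_smul_comm, mul_smul_comm,
        mul_assoc, mul_assoc, ← mul_assoc (D₂ k q), ← mul_assoc (D₁ k q) (D₂ k q), D₁_mul_D₂])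
    (by rw [← MulOpposite.op_mul, σ_mul_σInv, MulOpposite.op_one])
    (by rw [← MulOpposite.op_mul, σInv_mul_σ, MulOpposite.op_one])
    (by
      rw [← MulOpposite.op_mul, ← MulOpposite.op_mul, ← MulOpposite.op_smul, mul_neg, neg_mul,
        ← mul_assoc, σInv_mul_skew D₁_mul_σ, smul_mul_assoc, smul_neg])
    (by
      rw [← MulOpposite.op_mul, ← MulOpposite.op_mul, ← MulOpposite.op_smul, mul_neg, neg_mul,
        mul_assoc (σInv k q) (D₂ k q), smul_neg, ← mul_smul_comm,
        ← σInv_mul_skew D₂_mul_σ])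
    (fun l hl hq => by
      rw [← MulOpposite.op_pow, neg_pow,
        mul_pow_eq_zero_of_skew (σInv_mul_skew D₁_mul_σ) (D₁_pow hl hq), mul_zero,
        MulOpposite.op_zero])
    (fun l hl hq => by
      rw [← MulOpposite.op_pow, neg_pow, σInv_mul_skew D₂_mul_σ, smul_pow,
        mul_pow_eq_zero_of_skew (σInv_mul_skew D₂_mul_σ) (D₂_pow hl hq), smul_zero, mul_zero,
        MulOpposite.op_zero])

/-- The antipode of `H_q`. -/
def antipodeMap (k : Type*) [Field k] (q : kˣ) : Hq k q →ₗ[k] Hq k q :=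
  (MulOpposite.opLinearEquiv k).symm.toLinearMap ∘ₗ (antipodeHom k q).toLinearMap

theorem antipodeMap_apply (x : Hq k q) :
    antipodeMap k q x = MulOpposite.unop (antipodeHom k q x) := rfl

theorem antipodeMap_mul (x y : Hq k q) :
    antipodeMap k q (x * y) = antipodeMap k q y * antipodeMap k q x := by
  simp [antipodeMap_apply]

theorem antipodeMap_D₁ : antipodeMap k q (D₁ k q) = -(D₁ k q * σInv k q) := by
  simp [antipodeMap_apply, antipodeHom]

theorem antipodeMap_D₂ : antipodeMap k q (D₂ k q) = -(σInv k q * D₂ k q) := by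
  simp [antipodeMap_apply, antipodeHom]

theorem antipodeMap_σ : antipodeMap k q (σ k q) = σInv k q := by
  simp [antipodeMap_apply, antipodeHom]

theorem antipodeMap_σInv : antipodeMap k q (σInv k q) = σ k q := by
  simp [antipodeMap_apply, antipodeHom]

theorem antipodeMap_one : antipodeMap k q 1 = 1 := by
  simp [antipodeMap_apply]

theorem antipode_left (x : Hq k q) :
    LinearMap.mul' k (Hq k q) ((antipodeMap k q).rTensor (Hq k q) (Coalgebra.comul x)) =
      algebraMap k (Hq k q) (Coalgebra.counit x) := by
  induction x using Hq.induction with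
  | hD₁ => simp [comul_D₁, counit_D₁, antipodeMap_D₁, antipodeMap_one, mul_assoc, σInv_mul_σ]
  | hD₂ => simp [comul_D₂, counit_D₂, antipodeMap_D₂, antipodeMap_σ]
  | hσ => simp [comul_σ, counit_σ, antipodeMap_σ, σInv_mul_σ]
  | hσInv => simp [comul_σInv, counit_σInv, antipodeMap_σInv, σ_mul_σInv]
  | hs r => simp [Algebra.algebraMap_eq_smul_one, Algebra.TensorProduct.one_def, antipodeMap_one]
  | hadd x y hx hy => simp only [map_add, hx, hy]
  | hmul x y hx hy =>
    have key : ∀ u v : Hq k q ⊗[k] Hq k q,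
        LinearMap.mul' k (Hq k q) ((antipodeMap k q).rTensor (Hq k q) u) =
          algebraMap k (Hq k q) (Coalgebra.counit x) →
        LinearMap.mul' k (Hq k q) ((antipodeMap k q).rTensor (Hq k q) (u * v)) =
          (Coalgebra.counit x : k) •
            LinearMap.mul' k (Hq k q) ((antipodeMap k q).rTensor (Hq k q) v) := by
      intro u v hu
      induction v using TensorProduct.induction_on with
      | zero => simp
      | add v w hv hw => simp only [mul_add, map_add, hv, hw, smul_add]
      | tmul a b =>
        have : ∀ w : Hq k q ⊗[k] Hq k q,
            LinearMap.mul' k (Hq k q) ((antipodeMap k q).rTensor (Hq k q) (w * a ⊗ₜ b)) =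
              antipodeMap k q a *
                LinearMap.mul' k (Hq k q) ((antipodeMap k q).rTensor (Hq k q) w) * b := by
          intro w
          induction w using TensorProduct.induction_on with
          | zero => simp
          | add v w hv hw => simp only [add_mul, mul_add, map_add, hv, hw]
          | tmul c d => simp [antipodeMap_mul, mul_assoc]
        rw [this, hu]
        simp [Algebra.algebraMap_eq_smul_one]
    rw [Bialgebra.comul_mul, key _ _ hx, hy, Bialgebra.counit_mul, map_mul, Algebra.smul_def]

theorem antipode_right (x : Hq k q) :
    LinearMap.mul' k (Hq k q) ((antipodeMap k q).lTensor (Hq k q) (Coalgebra.comul x)) =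
      algebraMap k (Hq k q) (Coalgebra.counit x) := by
  induction x using Hq.induction with
  | hD₁ => simp [comul_D₁, counit_D₁, antipodeMap_D₁, antipodeMap_σ]
  | hD₂ => simp [comul_D₂, counit_D₂, antipodeMap_D₂, antipodeMap_one, ← mul_assoc, σ_mul_σInv]
  | hσ => simp [comul_σ, counit_σ, antipodeMap_σ, σ_mul_σInv]
  | hσInv => simp [comul_σInv, counit_σInv, antipodeMap_σInv, σInv_mul_σ]
  | hs r => simp [Algebra.algebraMap_eq_smul_one, Algebra.TensorProduct.one_def, antipodeMap_one]
  | hadd x y hx hy => simp only [map_add, hx, hy]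
  | hmul x y hx hy =>
    have key : ∀ u v : Hq k q ⊗[k] Hq k q,
        LinearMap.mul' k (Hq k q) ((antipodeMap k q).lTensor (Hq k q) v) =
          algebraMap k (Hq k q) (Coalgebra.counit y) →
        LinearMap.mul' k (Hq k q) ((antipodeMap k q).lTensor (Hq k q) (u * v)) =
          (Coalgebra.counit y : k) •
            LinearMap.mul' k (Hq k q) ((antipodeMap k q).lTensor (Hq k q) u) := by
      intro u v hv
      induction u using TensorProduct.induction_on with
      | zero => simp
      | add u w hu hw => simp only [add_mul, map_add, hu, hw, smul_add]
      | tmul a b =>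
        have : ∀ w : Hq k q ⊗[k] Hq k q,
            LinearMap.mul' k (Hq k q) ((antipodeMap k q).lTensor (Hq k q) (a ⊗ₜ b * w)) =
              a * LinearMap.mul' k (Hq k q) ((antipodeMap k q).lTensor (Hq k q) w) *
                antipodeMap k q b := by
          intro w
          induction w using TensorProduct.induction_on with
          | zero => simp
          | add v w hv hw => simp only [add_mul, mul_add, map_add, hv, hw]
          | tmul c d => simp [antipodeMap_mul, mul_assoc]
        rw [this, hv]
        simp [Algebra.algebraMap_eq_smul_one]
    rw [Bialgebra.comul_mul, key _ _ hy, hx, Bialgebra.counit_mul, mul_comm (Coalgebra.counit x : k),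
      map_mul, Algebra.smul_def]

instance instHopfAlgebra : HopfAlgebra k (Hq k q) where
  antipode := antipodeMap k q
  mul_antipode_rTensor_comul := LinearMap.ext antipode_left
  mul_antipode_lTensor_comul := LinearMap.ext antipode_right

end

end Hq

/-! ## Transpositions -/

section Transposition

variable {k H A : Type*} [Field k] [Ring H] [Algebra k H] [AddCommGroup A] [Module k A]

/-- For `s : H ⊗ A → A ⊗ H`, the composite
`(s ⊗ H) ∘ (H ⊗ s) : H ⊗ H ⊗ A → A ⊗ H ⊗ H`. -/
noncomputable def slideTwo (s : H ⊗[k] A →ₗ[k] A ⊗[k] H) :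
    H ⊗[k] (H ⊗[k] A) →ₗ[k] A ⊗[k] (H ⊗[k] H) :=
  (TensorProduct.assoc k A H H).toLinearMap ∘ₗ s.rTensor H ∘ₗ
    (TensorProduct.assoc k H A H).symm.toLinearMap ∘ₗ s.lTensor H

/-- `(A, s)` is a left `H`-braided space, where `H` is a bialgebra with braid `c : H ⊗ H → H ⊗ H`:
the map `s : H ⊗ A → A ⊗ H` is bijective, and compatible with the unit, multiplication, counit,
comultiplication and braid of `H`. -/
structure IsLeftBraidedSpace [Coalgebra k H] (c : H ⊗[k] H ≃ₗ[k] H ⊗[k] H)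
    (s : H ⊗[k] A →ₗ[k] A ⊗[k] H) : Prop where
  bijective : Function.Bijective s
  unit_left : ∀ a : A, s ((1 : H) ⊗ₜ[k] a) = a ⊗ₜ[k] (1 : H)
  mul_left : s ∘ₗ (LinearMap.mul' k H).rTensor A =
    (LinearMap.mul' k H).lTensor A ∘ₗ slideTwo s ∘ₗ (TensorProduct.assoc k H H A).toLinearMap
  counit_left : (TensorProduct.rid k A).toLinearMap ∘ₗ
      (Coalgebra.counit (R := k) (A := H)).lTensor A ∘ₗ s =
    (TensorProduct.lid k A).toLinearMap ∘ₗ (Coalgebra.counit (R := k) (A := H)).rTensor A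
  comul_left : (Coalgebra.comul (R := k) (A := H)).lTensor A ∘ₗ s =
    slideTwo s ∘ₗ (TensorProduct.assoc k H H A).toLinearMap ∘ₗ
      (Coalgebra.comul (R := k) (A := H)).rTensor A
  braid : slideTwo s ∘ₗ (TensorProduct.assoc k H H A).toLinearMap ∘ₗ c.toLinearMap.rTensor A =
    c.toLinearMap.lTensor A ∘ₗ slideTwo s ∘ₗ (TensorProduct.assoc k H H A).toLinearMap

end Transposition

/-- A left transposition of a bialgebra `H` with braid `c` on an algebra `A`: a structure of left
`H`-braided space on `A` which is compatible with the unit and the multiplication of `A`, i.e.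
`s ∘ (H ⊗ η_A) = η_A ⊗ H` and `s ∘ (H ⊗ μ_A) = (μ_A ⊗ H) ∘ (A ⊗ s) ∘ (s ⊗ A)`. -/
structure IsLeftTransposition {k H A : Type*} [Field k] [Ring H] [Algebra k H] [Coalgebra k H]
    [Ring A] [Algebra k A] (c : H ⊗[k] H ≃ₗ[k] H ⊗[k] H)
    (s : H ⊗[k] A →ₗ[k] A ⊗[k] H) : Prop extends IsLeftBraidedSpace c s where
  unit_right : ∀ h : H, s (h ⊗ₜ[k] (1 : A)) = (1 : A) ⊗ₜ[k] h
  mul_right : s ∘ₗ (LinearMap.mul' k A).lTensor H =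
    (LinearMap.mul' k A).rTensor H ∘ₗ (TensorProduct.assoc k A A H).symm.toLinearMap ∘ₗ
      s.lTensor A ∘ₗ (TensorProduct.assoc k A H A).toLinearMap ∘ₗ s.rTensor A ∘ₗ
      (TensorProduct.assoc k H A A).symm.toLinearMap

namespace Hq

/-- A linear map `s : H_q ⊗ A → A ⊗ H_q` is good if
`(s ⊗ H_q) ∘ (H_q ⊗ s) (D₁ ⊗ D₂ ⊗ a) = a ⊗ D₁ ⊗ D₂` for all `a`. -/
def IsGood {k A : Type*} [Field k] {q : kˣ} [Ring A] [Algebra k A]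
    (s : Hq k q ⊗[k] A →ₗ[k] A ⊗[k] Hq k q) : Prop :=
  ∀ a : A, slideTwo s (D₁ k q ⊗ₜ[k] (D₂ k q ⊗ₜ[k] a)) = a ⊗ₜ[k] (D₁ k q ⊗ₜ[k] D₂ k q)

/-- A good transposition of `H_q` on `A`. Here `H_q` is an ordinary Hopf algebra, so its braid is
the flip. -/
structure IsGoodTransposition {k A : Type*} [Field k] {q : kˣ} [Ring A] [Algebra k A]
    (s : Hq k q ⊗[k] A →ₗ[k] A ⊗[k] Hq k q) : Prop where
  isLeftTransposition : IsLeftTransposition (TensorProduct.comm k (Hq k q) (Hq k q)) s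
  isGood : IsGood s

end Hq

/-! Pairing the right factor of `A ⊗ H` with functionals replaces `s` by its matrix coefficients
`coeff s f h`, which are endomorphisms of `A`. Pairing `slideTwo s` with two functionals composes
the corresponding coefficients (`evalRightTwo_slideTwo`), and compatibility with the flip says that
all coefficients commute (`coeff_comm`). Goodness says that the `f`-coefficient of `D₁` after the
`g`-coefficient of `D₂` is the scalar `f(D₁)g(D₂)`. Since `D₁` and `D₂` are nonzero, normalized
functionals give mutually inverse maps `α` and `β`, and every other coefficient of `D₁` or `D₂` is
then a scalar multiple of one of them; so `s` sends `D₁ ⊗ a` to `α a ⊗ D₁` and `D₂ ⊗ a` to `β a ⊗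
D₂` (`exists_inverse`). Applying comultiplication to `D₁` isolates `σ`, and injectivity of `α`
forces `s` to be the flip there. Thus `α` determines `s` on generators, hence everywhere. For
existence, give `D₁`, `D₂`, `σ` the degrees `1`, `-1`, `0`. The relations and the coalgebra
structure are homogeneous, so `x ⊗ a ↦ (α ^ n) a ⊗ x` for `x` of degree `n` should work. To avoid
choosing a basis of `H_q`, this map is read off from an action of `H_q` on `A ⊗ H_q`, obtained from
the presentation; the axioms are checked on words, which span. -/

namespace Hq

/-! ### Matrix coefficients of a map `H ⊗ A → A ⊗ H`. -/

section Coefficients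

variable {k H A : Type*} [Field k] [Ring H] [Algebra k H] [Ring A] [Algebra k A]

/-- Evaluation of a linear functional of `H` in the right factor of `A ⊗ H`. -/
noncomputable def evalRight (A : Type*) [Ring A] [Algebra k A] (f : Module.Dual k H) :
    A ⊗[k] H →ₗ[k] A :=
  (TensorProduct.rid k A).toLinearMap ∘ₗ f.lTensor A

@[simp] theorem evalRight_tmul (f : Module.Dual k H) (a : A) (h : H) :
    evalRight A f (a ⊗ₜ[k] h) = f h • a := by
  simp [evalRight]

/-- Over a field both factors have bases, and the coordinate functionals of `H` already recover all
coordinates of a tensor. -/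
theorem ext_evalRight {u v : A ⊗[k] H}
    (h : ∀ f : Module.Dual k H, evalRight A f u = evalRight A f v) : u = v := by
  let b := Module.Basis.ofVectorSpace k A
  let c := Module.Basis.ofVectorSpace k H
  refine (b.tensorProduct c).ext_elem fun ij => ?_
  have key : ∀ w : A ⊗[k] H,
      (b.tensorProduct c).repr w ij = b.repr (evalRight A (c.coord ij.2) w) ij.1 := by
    intro w
    induction w using TensorProduct.induction_on with
    | zero => simp
    | add x y hx hy => simp [hx, hy]
    | tmul x y =>
      rw [Module.Basis.tensorProduct_repr_tmul_apply]
      simp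
  rw [key, key, h]

theorem tmul_right_injective {h : H} (hh : h ≠ 0) {a b : A} (e : a ⊗ₜ[k] h = b ⊗ₜ[k] h) :
    a = b := by
  obtain ⟨f, hf⟩ := Module.Projective.exists_dual_ne_zero k hh
  have := congrArg (evalRight A f) e
  rw [evalRight_tmul, evalRight_tmul] at this
  exact smul_right_injective A hf this

/-- The matrix coefficient `(A ⊗ f) s(h ⊗ -)` of `s : H ⊗ A → A ⊗ H`. -/
noncomputable def coeff (s : H ⊗[k] A →ₗ[k] A ⊗[k] H) (f : Module.Dual k H) (h : H) :
    A →ₗ[k] A :=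
  evalRight A f ∘ₗ s ∘ₗ TensorProduct.mk k H A h

theorem coeff_apply (s : H ⊗[k] A →ₗ[k] A ⊗[k] H) (f : Module.Dual k H) (h : H) (a : A) :
    coeff s f h a = evalRight A f (s (h ⊗ₜ[k] a)) := rfl

/-- Evaluation of two linear functionals of `H` in `A ⊗ H ⊗ H`. -/
noncomputable def evalRightTwo (A : Type*) [Ring A] [Algebra k A] (f g : Module.Dual k H) :
    A ⊗[k] (H ⊗[k] H) →ₗ[k] A :=
  (TensorProduct.rid k A).toLinearMap ∘ₗ
    ((TensorProduct.lid k k).toLinearMap ∘ₗ TensorProduct.map f g).lTensor A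

@[simp] theorem evalRightTwo_tmul (f g : Module.Dual k H) (a : A) (x y : H) :
    evalRightTwo A f g (a ⊗ₜ[k] (x ⊗ₜ[k] y)) = (f x * g y) • a := by
  simp [evalRightTwo]

theorem slideTwo_tmul (s : H ⊗[k] A →ₗ[k] A ⊗[k] H) (x y : H) (a : A) :
    slideTwo s (x ⊗ₜ[k] (y ⊗ₜ[k] a)) =
      TensorProduct.assoc k A H H (s.rTensor H ((TensorProduct.assoc k H A H).symm
        (x ⊗ₜ[k] s (y ⊗ₜ[k] a)))) := rfl

/-- The bridge from tensor identities to the algebra of endomorphisms of `A`: the axioms involving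
`slideTwo` become identities between composites of coefficients. -/
theorem evalRightTwo_slideTwo (s : H ⊗[k] A →ₗ[k] A ⊗[k] H) (f g : Module.Dual k H) (x y : H)
    (a : A) : evalRightTwo A f g (slideTwo s (x ⊗ₜ[k] (y ⊗ₜ[k] a))) =
      coeff s f x (coeff s g y a) := by
  rw [slideTwo_tmul, coeff_apply s g]
  have inner : ∀ (w : A ⊗[k] H) (z : H),
      evalRightTwo A f g (TensorProduct.assoc k A H H (w ⊗ₜ[k] z)) = g z • evalRight A f w := by
    intro w z
    induction w using TensorProduct.induction_on with
    | zero => simp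
    | add u v hu hv => simp [TensorProduct.add_tmul, hu, hv]
    | tmul b u => simp [smul_smul, mul_comm]
  induction s (y ⊗ₜ[k] a) using TensorProduct.induction_on with
  | zero => simp
  | add u v hu hv => simp only [TensorProduct.tmul_add, map_add, hu, hv]
  | tmul b z => simp [inner, coeff_apply]

/-- The flip exchanges the two elements on one side and the two functionals on the other. -/
theorem coeff_comm {s : H ⊗[k] A →ₗ[k] A ⊗[k] H}
    (hs : slideTwo s ∘ₗ (TensorProduct.assoc k H H A).toLinearMap ∘ₗ
        (TensorProduct.comm k H H).toLinearMap.rTensor A =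
      (TensorProduct.comm k H H).toLinearMap.lTensor A ∘ₗ slideTwo s ∘ₗ
        (TensorProduct.assoc k H H A).toLinearMap)
    (f g : Module.Dual k H) (x y : H) (a : A) :
    coeff s f x (coeff s g y a) = coeff s g y (coeff s f x a) := by
  have h : slideTwo s (y ⊗ₜ[k] (x ⊗ₜ[k] a)) =
      (TensorProduct.comm k H H).toLinearMap.lTensor A (slideTwo s (x ⊗ₜ[k] (y ⊗ₜ[k] a))) := by
    simpa using LinearMap.congr_fun hs ((x ⊗ₜ[k] y) ⊗ₜ[k] a)
  have swap : evalRightTwo A g f ∘ₗ (TensorProduct.comm k H H).toLinearMap.lTensor A =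
      evalRightTwo A f g := by
    ext b u v
    simp [mul_comm]
  rw [← evalRightTwo_slideTwo, ← evalRightTwo_slideTwo, h]
  exact (LinearMap.congr_fun swap _).symm

/-- A map compatible with the multiplication of `H` acts on products by composing. -/
theorem apply_mul_tmul {s : H ⊗[k] A →ₗ[k] A ⊗[k] H}
    (hs : s ∘ₗ (LinearMap.mul' k H).rTensor A =
      (LinearMap.mul' k H).lTensor A ∘ₗ slideTwo s ∘ₗ (TensorProduct.assoc k H H A).toLinearMap)
    (x y : H) (a : A) : s ((x * y) ⊗ₜ[k] a) =
      (LinearMap.mul' k H).lTensor A (slideTwo s (x ⊗ₜ[k] (y ⊗ₜ[k] a))) := by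
  simpa using LinearMap.congr_fun hs ((x ⊗ₜ[k] y) ⊗ₜ[k] a)

end Coefficients

/-! ### `D₁` and `D₂` are nonzero. -/

section Nonvanishing

variable {k : Type*} [Field k] {q : kˣ}

theorem e₁₂_sq : (!![0, 1; 0, 0] : Matrix (Fin 2) (Fin 2) k) ^ 2 = 0 := by
  rw [pow_two, Matrix.mul_fin_two]
  ext i j
  fin_cases i <;> fin_cases j <;> simp

variable (k q) in
/-- The two-dimensional representation of `H_q` in which `D₁` and `D₂` act by the elementary
matrix `e₁₂` and `σ` acts by `diag(1, q)`. -/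
noncomputable def matrixRep :
    Hq k q →ₐ[k] Matrix (Fin 2) (Fin 2) k :=
  lift !![0, 1; 0, 0] !![0, 1; 0, 0] !![1, 0; 0, (q : k)] !![1, 0; 0, (q : k)⁻¹]
    rfl (by simp [Matrix.one_fin_two]) (by simp [Matrix.one_fin_two])
    (by ext i j; fin_cases i <;> fin_cases j <;> simp)
    (by ext i j; fin_cases i <;> fin_cases j <;> simp)
    -- The square is already zero, so one representation serves every `l ≥ 2`, and also the case
    -- where the power relations are void.
    (fun l hl _ => pow_eq_zero_of_le hl e₁₂_sq)
    (fun l hl _ => pow_eq_zero_of_le hl e₁₂_sq)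

theorem D₁_ne_zero : D₁ k q ≠ 0 := fun h => by
  have := congrFun (congrFun (congrArg (matrixRep k q) h) 0) 1
  simp [matrixRep] at this

theorem D₂_ne_zero : D₂ k q ≠ 0 := fun h => by
  have := congrFun (congrFun (congrArg (matrixRep k q) h) 0) 1
  simp [matrixRep] at this

end Nonvanishing

/-! ### Rigidity of good transpositions. -/

section Good

variable {k A : Type*} [Field k] {q : kˣ} [Ring A] [Algebra k A]
  {s : Hq k q ⊗[k] A →ₗ[k] A ⊗[k] Hq k q}

/-- A good transposition acts on `D₁` and `D₂` by two mutually inverse maps. -/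
theorem IsGoodTransposition.exists_inverse (hs : IsGoodTransposition s) :
    ∃ α β : A →ₗ[k] A, (∀ a, α (β a) = a) ∧ (∀ a, β (α a) = a) ∧
      (∀ a, s (D₁ k q ⊗ₜ[k] a) = α a ⊗ₜ[k] D₁ k q) ∧
      (∀ a, s (D₂ k q ⊗ₜ[k] a) = β a ⊗ₜ[k] D₂ k q) := by
  obtain ⟨f₀, hf₀⟩ := Module.Projective.exists_dual_eq_one k (D₁_ne_zero (k := k) (q := q))
  obtain ⟨g₀, hg₀⟩ := Module.Projective.exists_dual_eq_one k (D₂_ne_zero (k := k) (q := q))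
  have comm := coeff_comm hs.isLeftTransposition.braid
  have good : ∀ (f g : Module.Dual k (Hq k q)) (a : A),
      coeff s f (D₁ k q) (coeff s g (D₂ k q) a) = (f (D₁ k q) * g (D₂ k q)) • a := by
    intro f g a
    rw [← evalRightTwo_slideTwo, hs.isGood a, evalRightTwo_tmul]
  have h₁ : ∀ a, coeff s f₀ (D₁ k q) (coeff s g₀ (D₂ k q) a) = a := fun a => by
    rw [good, hf₀, hg₀, mul_one, one_smul]
  -- Goodness gives a one-sided inverse only; commutation of coefficients supplies the other side.
  have h₂ : ∀ a, coeff s g₀ (D₂ k q) (coeff s f₀ (D₁ k q) a) = a := fun a => by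
    rw [comm, h₁]
  refine ⟨coeff s f₀ (D₁ k q), coeff s g₀ (D₂ k q), h₁, h₂, fun a => ?_, fun a => ?_⟩
  · refine ext_evalRight fun f => ?_
    rw [evalRight_tmul, ← coeff_apply]
    -- Writing `a` as `β (α a)` brings the coefficient at an arbitrary `f` into the form covered by
    -- `good`, with value `f(D₁)` times `α a`.
    conv_lhs => rw [← h₂ a]
    rw [good, hg₀, mul_one]
  · refine ext_evalRight fun g => ?_
    rw [evalRight_tmul, ← coeff_apply]
    conv_lhs => rw [← h₁ a]
    rw [comm, good, hf₀, one_mul]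

theorem IsGoodTransposition.apply_σ (hs : IsGoodTransposition s) (a : A) :
    s (σ k q ⊗ₜ[k] a) = a ⊗ₜ[k] σ k q := by
  obtain ⟨α, β, -, hβα, hα, -⟩ := hs.exists_inverse
  obtain ⟨f₀, hf₀⟩ := Module.Projective.exists_dual_eq_one k (D₁_ne_zero (k := k) (q := q))
  refine ext_evalRight fun f => ?_
  rw [evalRight_tmul, ← coeff_apply]
  -- In the comultiplication axiom at `D₁ ⊗ a` the contributions of `1 ⊗ D₁` agree on both sides and
  -- cancel.
  have h : α a ⊗ₜ[k] (D₁ k q ⊗ₜ[k] σ k q) =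
      slideTwo s (D₁ k q ⊗ₜ[k] (σ k q ⊗ₜ[k] a)) := by
    have h := LinearMap.congr_fun hs.isLeftTransposition.comul_left (D₁ k q ⊗ₜ[k] a)
    simpa [hα, comul_D₁, TensorProduct.tmul_add, TensorProduct.add_tmul, slideTwo_tmul,
      hs.isLeftTransposition.unit_left] using h
  have hc : ∀ b, coeff s f₀ (D₁ k q) b = α b := fun b => by
    rw [coeff_apply, hα, evalRight_tmul, hf₀, one_smul]
  have := congrArg (evalRightTwo A f₀ f) h
  rw [evalRightTwo_slideTwo, evalRightTwo_tmul, hf₀, one_mul, hc, ← map_smul] at this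
  -- At this point `α` takes the same value at `f(σ) • a` and at the `f`-coefficient of `σ`;
  -- applying `β` removes it.
  rw [← hβα (coeff s f (σ k q) a), ← this, hβα]

theorem IsGoodTransposition.apply_σInv (hs : IsGoodTransposition s) (a : A) :
    s (σInv k q ⊗ₜ[k] a) = a ⊗ₜ[k] σInv k q := by
  have h := apply_mul_tmul hs.isLeftTransposition.mul_left (σ k q) (σInv k q) a
  rw [σ_mul_σInv, hs.isLeftTransposition.unit_left, slideTwo_tmul] at h
  -- As `s` is the flip on `σ`, sliding `σ` past `w` and multiplying is left multiplication by `σ`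
  -- on the right factor, which `σInv` undoes. With `w = s (σInv ⊗ a)` and `σ * σInv = 1` this
  -- determines `w`.
  have key : ∀ w : A ⊗[k] Hq k q, (LinearMap.mulLeft k (σInv k q)).lTensor A
      ((LinearMap.mul' k (Hq k q)).lTensor A (TensorProduct.assoc k A _ _
        (s.rTensor _ ((TensorProduct.assoc k _ A _).symm (σ k q ⊗ₜ[k] w))))) = w := by
    intro w
    induction w using TensorProduct.induction_on with
    | zero => simp
    | add u v hu hv => simp only [TensorProduct.tmul_add, map_add, hu, hv]
    | tmul b z => simp [hs.apply_σ, ← mul_assoc, σInv_mul_σ]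
  rw [← key (s (σInv k q ⊗ₜ[k] a)), ← h]
  simp

/-- Both homomorphism laws come from the unit and multiplication axioms of `A` at `D₁`, by
cancelling the nonzero factor `D₁`. -/
theorem IsGoodTransposition.isAlgHom (hs : IsGoodTransposition s) {f : A → A}
    (hf : ∀ a : A, s (D₁ k q ⊗ₜ[k] a) = f a ⊗ₜ[k] D₁ k q) : ∃ α : A →ₐ[k] A, ⇑α = f := by
  obtain ⟨α, -, -, -, hα, -⟩ := hs.exists_inverse
  have hfα : ⇑α = f := funext fun a => tmul_right_injective (k := k) D₁_ne_zero
    ((hα a).symm.trans (hf a))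
  refine ⟨AlgHom.ofLinearMap α ?_ ?_, hfα⟩
  · exact tmul_right_injective (k := k) D₁_ne_zero
      ((hα 1).symm.trans (hs.isLeftTransposition.unit_right _))
  · intro a b
    refine tmul_right_injective (k := k) (D₁_ne_zero (q := q)) ?_
    have h := LinearMap.congr_fun hs.isLeftTransposition.mul_right (D₁ k q ⊗ₜ[k] (a ⊗ₜ[k] b))
    simpa [hα] using h

/-- Two good transpositions that agree on `D₁` and `D₂` are equal. -/
theorem IsGoodTransposition.ext_D₁_D₂ {t : Hq k q ⊗[k] A →ₗ[k] A ⊗[k] Hq k q}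
    (hs : IsGoodTransposition s) (ht : IsGoodTransposition t)
    (h₁ : ∀ a, s (D₁ k q ⊗ₜ[k] a) = t (D₁ k q ⊗ₜ[k] a))
    (h₂ : ∀ a, s (D₂ k q ⊗ₜ[k] a) = t (D₂ k q ⊗ₜ[k] a)) : s = t := by
  refine TensorProduct.ext' fun h => ?_
  induction h using Hq.induction with
  | hD₁ => exact h₁
  | hD₂ => exact h₂
  | hσ => intro a; rw [hs.apply_σ, ht.apply_σ]
  | hσInv => intro a; rw [hs.apply_σInv, ht.apply_σInv]
  | hs r =>
    intro a
    rw [Algebra.algebraMap_eq_smul_one, ← TensorProduct.smul_tmul', map_smul, map_smul,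
      hs.isLeftTransposition.unit_left, ht.isLeftTransposition.unit_left]
  | hadd x y hx hy => intro a; rw [TensorProduct.add_tmul, map_add, map_add, hx, hy]
  | hmul x y hx hy =>
    intro a
    rw [apply_mul_tmul hs.isLeftTransposition.mul_left,
      apply_mul_tmul ht.isLeftTransposition.mul_left, slideTwo_tmul, slideTwo_tmul, hy]
    congr 2
    induction t (y ⊗ₜ[k] a) using TensorProduct.induction_on with
    | zero => simp
    | add u v hu hv => simp only [TensorProduct.tmul_add, map_add, hu, hv]
    | tmul b z => simp [hx]

end Good

/-! ### The degree on words and its compatibility with comultiplication. -/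

section Words

variable {k : Type*} [Field k] {q : kˣ}

/-- Words in the generators of `H_q`, with the degree for which `D₁` has degree `1`, `D₂` has degree
`-1` and `σ^{±1}` has degree `0`. -/
inductive IsWord : Hq k q → ℤ → Prop
  | one : IsWord 1 0
  | D₁ : IsWord (D₁ k q) 1
  | D₂ : IsWord (D₂ k q) (-1)
  | σ : IsWord (σ k q) 0
  | σInv : IsWord (σInv k q) 0
  | mul {x y : Hq k q} {m n : ℤ} : IsWord x m → IsWord y n → IsWord (x * y) (m + n)

theorem span_isWord : Submodule.span k {h : Hq k q | ∃ n, IsWord h n} = ⊤ := by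
  refine eq_top_iff.2 fun x _ => ?_
  induction x using Hq.induction with
  | hD₁ => exact Submodule.subset_span ⟨_, .D₁⟩
  | hD₂ => exact Submodule.subset_span ⟨_, .D₂⟩
  | hσ => exact Submodule.subset_span ⟨_, .σ⟩
  | hσInv => exact Submodule.subset_span ⟨_, .σInv⟩
  | hs r =>
    rw [Algebra.algebraMap_eq_smul_one]
    exact Submodule.smul_mem _ _ (Submodule.subset_span ⟨_, .one⟩)
  | hadd x y hx hy => exact add_mem (hx trivial) (hy trivial)
  | hmul x y hx hy =>
    have h := Submodule.mul_mem_mul (hx trivial) (hy trivial)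
    rw [Submodule.span_mul_span] at h
    refine Submodule.span_mono ?_ h
    rintro _ ⟨u, ⟨m, hu⟩, v, ⟨n, hv⟩, rfl⟩
    exact ⟨_, hu.mul hv⟩

theorem linearMap_ext_isWord {M : Type*} [AddCommGroup M] [Module k M] {f g : Hq k q →ₗ[k] M}
    (h : ∀ x n, IsWord x n → f x = g x) : f = g :=
  LinearMap.ext_on span_isWord fun x ⟨n, hx⟩ => h x n hx

/-- Comultiplication preserves total degree: this is visible on generators, and degrees add under
products. -/
theorem IsWord.comul_mem {x : Hq k q} {n : ℤ} (hx : IsWord x n) :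
    Coalgebra.comul (R := k) x ∈ Submodule.span k
      {w : Hq k q ⊗[k] Hq k q | ∃ y z i j, IsWord y i ∧ IsWord z j ∧ i + j = n ∧ w = y ⊗ₜ z} := by
  induction hx with
  | one => exact Submodule.subset_span ⟨1, 1, 0, 0, .one, .one, rfl, Bialgebra.comul_one⟩
  | D₁ =>
    rw [comul_D₁]
    exact add_mem (Submodule.subset_span ⟨_, _, 1, 0, .D₁, .σ, rfl, rfl⟩)
      (Submodule.subset_span ⟨_, _, 0, 1, .one, .D₁, rfl, rfl⟩)
  | D₂ =>
    rw [comul_D₂]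
    exact add_mem (Submodule.subset_span ⟨_, _, -1, 0, .D₂, .one, rfl, rfl⟩)
      (Submodule.subset_span ⟨_, _, 0, -1, .σ, .D₂, rfl, rfl⟩)
  | σ => rw [comul_σ]; exact Submodule.subset_span ⟨_, _, 0, 0, .σ, .σ, rfl, rfl⟩
  | σInv => rw [comul_σInv]; exact Submodule.subset_span ⟨_, _, 0, 0, .σInv, .σInv, rfl, rfl⟩
  | mul _ _ hx hy =>
    have h := Submodule.mul_mem_mul hx hy
    rw [Submodule.span_mul_span] at h
    rw [Bialgebra.comul_mul]
    refine Submodule.span_mono ?_ h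
    rintro _ ⟨_, ⟨y, z, i, j, hy, hz, e, rfl⟩, _, ⟨y', z', i', j', hy', hz', e', rfl⟩, rfl⟩
    exact ⟨_, _, _, _, hy.mul hy', hz.mul hz', by omega, Algebra.TensorProduct.tmul_mul_tmul ..⟩

end Words

/-! ### The transposition attached to an automorphism. -/

section Existence

variable {k A : Type*} [Field k] {q : kˣ} [Ring A] [Algebra k A]

/-- The action of `H_q` on `A ⊗ H_q` twisting the left multiplication by powers of `α`. -/
noncomputable def twistedAction (q : kˣ) (α : A ≃ₐ[k] A) :
    Hq k q →ₐ[k] Module.End k (A ⊗[k] Hq k q) :=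
  lift (TensorProduct.map α.toLinearMap (LinearMap.mulLeft k (D₁ k q)))
    (TensorProduct.map α.symm.toLinearMap (LinearMap.mulLeft k (D₂ k q)))
    (TensorProduct.map LinearMap.id (LinearMap.mulLeft k (σ k q)))
    (TensorProduct.map LinearMap.id (LinearMap.mulLeft k (σInv k q)))
    (TensorProduct.ext' fun a h => by simp [← mul_assoc, D₁_mul_D₂])
    (TensorProduct.ext' fun a h => by simp [← mul_assoc, σ_mul_σInv])
    (TensorProduct.ext' fun a h => by simp [← mul_assoc, σInv_mul_σ])
    (TensorProduct.ext' fun a h => by simp [← mul_assoc, D₁_mul_σ])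
    (TensorProduct.ext' fun a h => by simp [← mul_assoc, D₂_mul_σ])
    (fun l hl hq => by
      rw [TensorProduct.map_pow, LinearMap.pow_mulLeft, D₁_pow hl hq, LinearMap.mulLeft_zero_eq_zero,
        TensorProduct.map_zero_right])
    (fun l hl hq => by
      rw [TensorProduct.map_pow, LinearMap.pow_mulLeft, D₂_pow hl hq, LinearMap.mulLeft_zero_eq_zero,
        TensorProduct.map_zero_right])

/-- Exponents of `α` add along a product exactly as degrees do. -/
theorem twistedAction_apply (α : A ≃ₐ[k] A) {x : Hq k q} {n : ℤ} (hx : IsWord x n) (a : A)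
    (h : Hq k q) : twistedAction q α x (a ⊗ₜ[k] h) = (α ^ n) a ⊗ₜ[k] (x * h) := by
  induction hx generalizing a h with
  | one => simp
  | D₁ => simp [twistedAction]
  | D₂ => simp [twistedAction]
  | σ => simp [twistedAction]
  | σInv => simp [twistedAction]
  | mul _ _ hx hy => rw [map_mul, Module.End.mul_apply, hy, hx, zpow_add, mul_assoc]; rfl

/-- The good transposition attached to an automorphism of `A`. -/
noncomputable def twist (q : kˣ) (α : A ≃ₐ[k] A) : Hq k q ⊗[k] A →ₗ[k] A ⊗[k] Hq k q :=
  TensorProduct.lift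
    ((LinearMap.lcomp k _ ((TensorProduct.mk k A (Hq k q)).flip 1)) ∘ₗ
      (twistedAction q α).toLinearMap)

theorem twist_tmul (α : A ≃ₐ[k] A) {x : Hq k q} {n : ℤ} (hx : IsWord x n) (a : A) :
    twist q α (x ⊗ₜ[k] a) = (α ^ n) a ⊗ₜ[k] x := by
  have h : twist q α (x ⊗ₜ[k] a) = twistedAction q α x (a ⊗ₜ[k] 1) := by simp [twist]
  rw [h, twistedAction_apply α hx, mul_one]

theorem slideTwo_twist (α : A ≃ₐ[k] A) {x y : Hq k q} {m n : ℤ} (hx : IsWord x m)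
    (hy : IsWord y n) (a : A) :
    slideTwo (twist q α) (x ⊗ₜ[k] (y ⊗ₜ[k] a)) = (α ^ (m + n)) a ⊗ₜ[k] (x ⊗ₜ[k] y) := by
  simp [slideTwo_tmul, twist_tmul α hx, twist_tmul α hy, zpow_add]

/-- A linear map out of `H_q ⊗ A` is determined by its values on words. -/
theorem tensor_ext_isWord {M : Type*} [AddCommGroup M] [Module k M]
    {f g : Hq k q ⊗[k] A →ₗ[k] M}
    (h : ∀ x n a, IsWord x n → f (x ⊗ₜ[k] a) = g (x ⊗ₜ[k] a)) : f = g :=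
  TensorProduct.ext (linearMap_ext_isWord fun x n hx => LinearMap.ext fun a => h x n a hx)

/-- A linear map out of `H_q ⊗ H_q ⊗ A` is determined by its values on words. -/
theorem tensor_ext_isWord_two {M : Type*} [AddCommGroup M] [Module k M]
    {f g : (Hq k q ⊗[k] Hq k q) ⊗[k] A →ₗ[k] M}
    (h : ∀ x m y n a, IsWord x m → IsWord y n →
      f ((x ⊗ₜ[k] y) ⊗ₜ[k] a) = g ((x ⊗ₜ[k] y) ⊗ₜ[k] a)) : f = g := by
  refine TensorProduct.ext (TensorProduct.ext ?_)
  exact linearMap_ext_isWord fun x m hx => linearMap_ext_isWord fun y n hy =>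
    LinearMap.ext fun a => h x m y n a hx hy

/-- A word containing `D₁` or `D₂` has counit zero, and any other word has degree zero, so the twist
is invisible to the counit. -/
theorem IsWord.counit_smul (α : A ≃ₐ[k] A) {x : Hq k q} {n : ℤ} (hx : IsWord x n) (a : A) :
    (Coalgebra.counit x : k) • (α ^ n) a = (Coalgebra.counit x : k) • a := by
  induction hx generalizing a with
  | one => simp
  | D₁ => simp [counit_D₁]
  | D₂ => simp [counit_D₂]
  | σ => simp
  | σInv => simp
  | mul _ _ hx hy =>
    rw [Bialgebra.counit_mul, mul_smul, zpow_add, AlgEquiv.mul_apply, smul_comm, hx, smul_comm, hy,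
      ← mul_smul]

/-- The inverse is the twist by `α⁻¹`, conjugated by the flips. -/
theorem twist_bijective (α : A ≃ₐ[k] A) : Function.Bijective (twist q α) := by
  let t : A ⊗[k] Hq k q →ₗ[k] Hq k q ⊗[k] A :=
    (TensorProduct.comm k A (Hq k q)).toLinearMap ∘ₗ twist q α⁻¹ ∘ₗ
      (TensorProduct.comm k A (Hq k q)).toLinearMap
  have h₁ : t ∘ₗ twist q α = LinearMap.id := tensor_ext_isWord fun x n a hx => by
    simp [t, twist_tmul _ hx, ← AlgEquiv.mul_apply]
  have cancel : ∀ (n : ℤ) (a : A), (α ^ n) ((α ^ n).symm a) = a := fun n a =>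
    (α ^ n).apply_symm_apply a
  have h₂ : (twist q α ∘ₗ t) ∘ₗ (TensorProduct.comm k (Hq k q) A).toLinearMap =
      (TensorProduct.comm k (Hq k q) A).toLinearMap := tensor_ext_isWord fun x n a hx => by
    simp [t, twist_tmul _ hx, cancel]
  refine Function.bijective_iff_has_inverse.2 ⟨t, LinearMap.congr_fun h₁, fun u => ?_⟩
  simpa using LinearMap.congr_fun h₂ ((TensorProduct.comm k (Hq k q) A).symm u)

theorem twist_isGoodTransposition (α : A ≃ₐ[k] A) : IsGoodTransposition (twist q α) where
  isLeftTransposition :=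
    { bijective := twist_bijective α
      unit_left := fun a => by simpa using twist_tmul α (q := q) .one a
      mul_left := tensor_ext_isWord_two fun x m y n a hx hy => by
        simp [twist_tmul α (hx.mul hy), slideTwo_twist α hx hy]
      counit_left := tensor_ext_isWord fun x n a hx => by
        simp [twist_tmul α hx, hx.counit_smul α]
      comul_left := tensor_ext_isWord fun x n a hx => by
        simp only [LinearMap.comp_apply, twist_tmul α hx, LinearMap.lTensor_tmul,
          LinearMap.rTensor_tmul]
        have h := hx.comul_mem
        -- Only membership in the span of homogeneous tensors of total degree `n` matters; the
        -- identity is linear in `w`.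
        generalize (Coalgebra.comul (R := k) x) = w at h ⊢
        induction h using Submodule.span_induction with
        | mem w hw =>
          obtain ⟨y, z, i, j, hy, hz, rfl, rfl⟩ := hw
          simp [slideTwo_twist α hy hz]
        | zero => simp
        | add u v _ _ hu hv =>
          simp only [TensorProduct.tmul_add, TensorProduct.add_tmul, map_add, hu, hv]
        | smul r u _ hu =>
          simp only [TensorProduct.tmul_smul, ← TensorProduct.smul_tmul', map_smul, hu]
      braid := tensor_ext_isWord_two fun x m y n a hx hy => by
        simp [slideTwo_twist α hx hy, slideTwo_twist α hy hx, add_comm]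
      unit_right := LinearMap.congr_fun (linearMap_ext_isWord
        (f := twist q α ∘ₗ (TensorProduct.mk k _ A).flip 1) (g := TensorProduct.mk k A _ 1)
        fun x n hx => by simp [twist_tmul α hx])
      mul_right := by
        refine TensorProduct.ext (linearMap_ext_isWord fun x n hx => ?_)
        refine TensorProduct.ext' fun a b => ?_
        simp [twist_tmul α hx] }
  isGood := fun a => by simpa using slideTwo_twist α (q := q) .D₁ .D₂ a

end Existence

end Hq

theorem mainTheorem11 {k : Type*} [Field k] (q : kˣ) (A : Type*) [Ring A] [Algebra k A] :
    (∀ s : Hq k q ⊗[k] A →ₗ[k] A ⊗[k] Hq k q, Hq.IsGoodTransposition s →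
      (∀ a : A, s (Hq.σ k q ⊗ₜ[k] a) = a ⊗ₜ[k] Hq.σ k q) ∧
      (∀ a : A, s (Hq.σInv k q ⊗ₜ[k] a) = a ⊗ₜ[k] Hq.σInv k q) ∧
      (∃! f : A → A, ∀ a : A, s (Hq.D₁ k q ⊗ₜ[k] a) = f a ⊗ₜ[k] Hq.D₁ k q) ∧
      (∀ f : A → A, (∀ a : A, s (Hq.D₁ k q ⊗ₜ[k] a) = f a ⊗ₜ[k] Hq.D₁ k q) →
        ∃ α : A →ₐ[k] A, ⇑α = f)) ∧
    (∀ α : A ≃ₐ[k] A, ∃! s : Hq k q ⊗[k] A →ₗ[k] A ⊗[k] Hq k q,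
      Hq.IsGoodTransposition s ∧
        ∀ a : A, s (Hq.D₁ k q ⊗ₜ[k] a) = α a ⊗ₜ[k] Hq.D₁ k q) := by
  refine ⟨fun s hs => ⟨hs.apply_σ, hs.apply_σInv, ?_, fun f hf => hs.isAlgHom hf⟩, fun α => ?_⟩
  · obtain ⟨α, -, -, -, hα, -⟩ := hs.exists_inverse
    exact ⟨α, hα, fun f hf => funext fun a =>
      Hq.tmul_right_injective (k := k) Hq.D₁_ne_zero ((hf a).symm.trans (hα a))⟩
  · have hD₁ : ∀ a, Hq.twist q α (Hq.D₁ k q ⊗ₜ[k] a) = α a ⊗ₜ[k] Hq.D₁ k q := fun a => by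
      simpa using Hq.twist_tmul α (q := q) .D₁ a
    refine ⟨Hq.twist q α, ⟨Hq.twist_isGoodTransposition α, hD₁⟩, ?_⟩
    rintro s ⟨hs, hsα⟩
    refine Hq.IsGoodTransposition.ext_D₁_D₂ hs (Hq.twist_isGoodTransposition α)
      (fun a => (hsα a).trans (hD₁ a).symm) fun a => ?_
    -- The action on `D₂` is not prescribed, but it is inverse to the one on `D₁`, hence equal to
    -- `α.symm`.
    obtain ⟨γ, β, -, hβγ, hγ, hβ⟩ := hs.exists_inverse
    have hγα : ∀ b, γ b = α b := fun b =>
      Hq.tmul_right_injective (k := k) Hq.D₁_ne_zero ((hγ b).symm.trans (hsα b))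
    have hβα : β a = α.symm a := by
      conv_lhs => rw [← α.apply_symm_apply a, ← hγα, hβγ]
    rw [hβ, Hq.twist_tmul α .D₂, hβα, zpow_neg_one]
    rfl
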